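/- Let $\mathbb{N}=\{1,2,\dots\}$ and let $H$ be a self-adjoint operator on $l^2(\mathbb{N};\mathbb{C}^N)$ acting by $$[H\psi]_m = A(m-1)^*\psi_{m-1}+V(m)\psi_m+A(m)\psi_{m+1},\qquad m\in\mathbb{N},\quad \psi_0:=0,$$ with complex $N\times N$ matrices $A(m)$ and Hermitian $N\times N$ matrices $V(m)$, $m \in \mathbb{N}$. Suppose that $M\ge 0$ is an integer such that $A(m+1)=A(m)$ and $V(m+1)=V(m)$ for all $m\in\mathbb{N}$ with $m\ge M$, and let $A^\infty$, $V^\infty$ denote the common values of $A(m)$, $V(m)$ for $m\in\mathbb{N}$, $m\geq M$. Let $z\in\mathbb{C}\setminus\sigma(H)$ and put $$S(z)=\begin{bmatrix}-A^\infty&0\\ z-V^\infty&-A^\infty\end{bmatrix}\in\mathbb{C}^{2N\times 2N}.$$ Assume that $S(z)$ is either invertible or of the form $$S(z)=\begin{bmatrix}0&0&0\\ M_{11}&M_{12}&0\\ M_{21}&M_{22}&0\end{bmatrix}$$ with row and column blocks of sizes $n,2k,n$, where $k=N-n>0$, such that $M_{21}$ and $M_{12}-M_{11}M_{21}^{-1}M_{22}$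 are invertible. Then there is an $N$-dimensional subspace $V_{\rm decaying}\subset\mathbb{C}^{2N}$, depending only on $A^\infty,V^\infty,z$ (namely the set of all $[h_1,h_2]^{\mathsf T}$ where $h\in l^2(\mathbb{N};\mathbb{C}^N)$ satisfies $-(A^\infty)^*h_{m-1}+(z-V^\infty)h_m-A^\infty h_{m+1}=0$ for all $m\ge 2$), with the following property. For every right-hand side $(f_m)_{m\in\mathbb{N}}$ in $\mathbb{C}^N$ with $f_m=0$ for $m>M$, the system $$-A(m-1)^*g_{m-1}+(z-V(m))g_m-A(m)g_{m+1}=f_m\quad(m\in\mathbb{N}),\qquad g_0=0,$$ has a unique solution $g\in l^2(\mathbb{N};\mathbb{C}^N)$, and $(g_1,\dots,g_{M+2})$ is the unique solution in $(\mathbb{C}^N)^{M+2}$ of the truncated problem consisting of the equations $m=1,\dots,M+1$ of this system (with $g_0=0$) and the boundary condition $[g_{M+1},g_{M+2}]^{\mathsf T}\in V_{\rm decaying}$. -/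

import Mathlib

open Matrix

noncomputable section

namespace EventuallyPeriodic

/-- The Hilbert space `l²(ℕ; ℂ^N)`, with `ℕ = {1, 2, …}`. -/
abbrev L2 (N : ℕ) : Type := lp (fun _ : ℕ+ => EuclideanSpace ℂ (Fin N)) 2

/-- The cells `ψ_1, ψ_2, …` of `ψ`, extended by `ψ_0 = 0`. -/
def cell {N : ℕ} (ψ : L2 N) : ℕ → Fin N → ℂ
  | 0 => 0
  | m + 1 => fun i => ψ m.succPNat i

/-- The cells `u_1, …, u_K` of a finite block vector (`u_m` is stored at index `m - 1`),
extended by zero to all other cell numbers. -/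
def finCell {N K : ℕ} (u : Fin K → Fin N → ℂ) : ℕ → Fin N → ℂ
  | 0 => 0
  | m + 1 => if h : m < K then u ⟨m, h⟩ else 0

/-- `H` is a self-adjoint operator on `l²(ℕ; ℂ^N)` of range `R = 1`:
`[Hψ]_m = A(m-1)^* ψ_{m-1} + V(m) ψ_m + A(m) ψ_{m+1}` for all `m ≥ 1`, with `V(m)` Hermitian.
The values `A 0` and `V 0` play no role, because `ψ_0 = 0`. -/
structure IsNearestNeighbour {N : ℕ} (H : L2 N →L[ℂ] L2 N)
    (A V : ℕ → Matrix (Fin N) (Fin N) ℂ) : Prop where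
  selfAdjoint : IsSelfAdjoint H
  hermitian : ∀ m, 1 ≤ m → (V m).IsHermitian
  action : ∀ (ψ : L2 N) (m : ℕ), 1 ≤ m →
    cell (H ψ) m
      = (A (m - 1))ᴴ *ᵥ cell ψ (m - 1) + V m *ᵥ cell ψ m + A m *ᵥ cell ψ (m + 1)

/-- The coefficients are constant from cell `M` on. -/
def IsPeriodicFrom {N : ℕ} (M : ℕ) (A V : ℕ → Matrix (Fin N) (Fin N) ℂ) : Prop :=
  ∀ m, 1 ≤ m → M ≤ m → V (m + 1) = V m ∧ A (m + 1) = A m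

/-- `-A(m-1)^* g_{m-1} + (z - V(m)) g_m - A(m) g_{m+1}`. -/
def greenLHS {N : ℕ} (A V : ℕ → Matrix (Fin N) (Fin N) ℂ) (z : ℂ)
    (g : ℕ → Fin N → ℂ) (m : ℕ) : Fin N → ℂ :=
  -((A (m - 1))ᴴ *ᵥ g (m - 1)) + (z • (1 : Matrix (Fin N) (Fin N) ℂ) - V m) *ᵥ g m
    - A m *ᵥ g (m + 1)

/-- `g ∈ l²(ℕ; ℂ^N)` solves the difference equation with right-hand side `f` in all cells. -/
def SolvesGreen {N : ℕ} (A V : ℕ → Matrix (Fin N) (Fin N) ℂ) (z : ℂ)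
    (f : ℕ → Fin N → ℂ) (g : L2 N) : Prop :=
  ∀ m, 1 ≤ m → greenLHS A V z (cell g) m = f m

/-- `u = (u_1, …, u_{M+2})` solves the system truncated after `M + 2` cells: these are the
equations `m = 1, …, M + 1`, which are all the equations involving no cell after `M + 2`. -/
def SolvesTruncated {N : ℕ} (M : ℕ) (A V : ℕ → Matrix (Fin N) (Fin N) ℂ) (z : ℂ)
    (f : ℕ → Fin N → ℂ) (u : Fin (M + 2) → Fin N → ℂ) : Prop :=
  ∀ m, 1 ≤ m → m ≤ M + 1 → greenLHS A V z (finCell u) m = f m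

/-- The matrix `S(z) = [[-A, 0], [z - V, -A]]`. -/
def SMatrix {N : ℕ} (A V : Matrix (Fin N) (Fin N) ℂ) (z : ℂ) :
    Matrix (Fin N ⊕ Fin N) (Fin N ⊕ Fin N) ℂ :=
  fromBlocks (-A) 0 (z • (1 : Matrix (Fin N) (Fin N) ℂ) - V) (-A)

/-- The order-preserving splitting of the rows of a `2N × 2N` matrix (`N = n + m`) into
consecutive groups of `n`, `2m`, `n`. -/
def rowSplit {N n m : ℕ} (h : n + m = N) :
    Fin n ⊕ (Fin (2 * m) ⊕ Fin n) ≃ Fin N ⊕ Fin N :=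
  ((Equiv.sumCongr (Equiv.refl _) finSumFinEquiv).trans finSumFinEquiv).trans
    ((finCongr (by omega)).trans finSumFinEquiv.symm)

/-- The order-preserving splitting of the columns of a `2N × 2N` matrix (`N = n + m`) into
consecutive groups of `n`, `2m`, `n`. -/
def colSplit {N n m : ℕ} (h : n + m = N) :
    (Fin n ⊕ Fin (2 * m)) ⊕ Fin n ≃ Fin N ⊕ Fin N :=
  ((Equiv.sumCongr finSumFinEquiv (Equiv.refl _)).trans finSumFinEquiv).trans
    ((finCongr (by omega)).trans finSumFinEquiv.symm)

/-- `S = [[0, 0, 0], [M₁₁, M₁₂, 0], [M₂₁, M₂₂, 0]]` with row and column groups of sizes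
`n, 2m, n`, where `m = N - n > 0`, and with `M₂₁` and `M₁₂ - M₁₁ M₂₁⁻¹ M₂₂` invertible. -/
def HasSingularForm {N : ℕ} (S : Matrix (Fin N ⊕ Fin N) (Fin N ⊕ Fin N) ℂ) : Prop :=
  ∃ (n m : ℕ) (h : n + m = N) (M₁₁ : Matrix (Fin (2 * m)) (Fin n) ℂ)
    (M₁₂ : Matrix (Fin (2 * m)) (Fin (2 * m)) ℂ) (M₂₁ : Matrix (Fin n) (Fin n) ℂ)
    (M₂₂ : Matrix (Fin n) (Fin (2 * m)) ℂ),
    0 < m ∧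
    S.submatrix (rowSplit h) (colSplit h)
      = fromBlocks 0 0 (fromBlocks M₁₁ M₁₂ M₂₁ M₂₂) 0 ∧
    IsUnit M₂₁ ∧ IsUnit (M₁₂ - M₁₁ * M₂₁⁻¹ * M₂₂)

/-- `x = [h_1, h_2]` for some `h ∈ l²(ℕ; ℂ^N)` with
`-A^* h_{m-1} + (z - V) h_m - A h_{m+1} = 0` for all `m ≥ 2`, where `A`, `V` do not depend
on `m`. -/
def IsDecayingData {N : ℕ} (A V : Matrix (Fin N) (Fin N) ℂ) (z : ℂ)
    (x : Fin N ⊕ Fin N → ℂ) : Prop :=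
  ∃ h : L2 N, (∀ m, 2 ≤ m → greenLHS (fun _ => A) (fun _ => V) z (cell h) m = 0) ∧
    x = Sum.elim (cell h 1) (cell h 2)

end EventuallyPeriodic

end

open Matrix

noncomputable section

namespace EventuallyPeriodic

variable {N : ℕ}

/-! ### Cells of square-summable sequences -/

/-! Since `z` is not in the spectrum, `z - H` is a linear bijection `T` of `l²`, which gives
existence and uniqueness of `g`. Shifting `l²` sequences, and gluing finitely many cells in front of
them, stays in `l²`. Hence decaying data are exactly the cells `M + 1`, `M + 2` of `T⁻¹ F` with `F`
supported in the cells `1, …, M + 1`, a space of dimension `(M + 1)N`. If both of these cells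
vanish, so does the whole tail, because the kernel of `S(z)` has zero first half
(`eq_zero_of_greenLHS_eq_zero`). Such `F` are thus the images under `T` of the sequences supported
in `1, …, M`, which form a space of dimension `MN`. Rank-nullity leaves dimension `N`. -/

theorem cell_add (φ ψ : L2 N) (m : ℕ) : cell (φ + ψ) m = cell φ m + cell ψ m := by
  cases m with
  | zero => simp [cell]
  | succ m => ext i; simp [cell]

theorem cell_sub (φ ψ : L2 N) (m : ℕ) : cell (φ - ψ) m = cell φ m - cell ψ m := by
  cases m with
  | zero => simp [cell]
  | succ m => ext i; simp [cell]

theorem cell_smul (c : ℂ) (ψ : L2 N) (m : ℕ) : cell (c • ψ) m = c • cell ψ m := by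
  cases m with
  | zero => simp [cell]
  | succ m => ext i; simp [cell]

theorem cell_ext {φ ψ : L2 N} (h : ∀ m, 1 ≤ m → cell φ m = cell ψ m) : φ = ψ := by
  ext p i
  have := congrFun (h (p.natPred + 1) (by omega)) i
  simpa [cell] using this

/-- A sequence consists of the cells of an element of `l²` iff it is square-summable. -/
theorem exists_cell_eq_iff_summable (c : ℕ → Fin N → ℂ) :
    (∃ g : L2 N, ∀ m, 1 ≤ m → cell g m = c m) ↔
      Summable fun m : ℕ => ‖WithLp.toLp 2 (c (m + 1))‖ ^ (2 : ℝ) := by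
  have key : ∀ a : ℕ+ → EuclideanSpace ℂ (Fin N),
      Memℓp a 2 ↔ Summable fun m : ℕ => ‖a m.succPNat‖ ^ (2 : ℝ) := by
    intro a
    rw [memℓp_gen_iff (by norm_num)]
    exact (Equiv.pnatEquivNat.symm.summable_iff
      (f := fun i => ‖a i‖ ^ (2 : ENNReal).toReal)).symm.trans (by simp [Function.comp_def])
  constructor
  · rintro ⟨g, hg⟩
    refine ((key g).1 (lp.memℓp g)).congr fun m => ?_
    rw [← hg (m + 1) (by omega)]
    rfl
  · intro h
    refine ⟨⟨fun p => WithLp.toLp 2 (c p), (key _).2 (by simpa using h)⟩, fun m hm => ?_⟩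
    obtain ⟨m, rfl⟩ := Nat.exists_eq_add_of_le' hm
    rfl

/-- Whether a sequence is square-summable depends only on its tail. -/
theorem exists_cell_eq_shift_iff (c : ℕ → Fin N → ℂ) (k : ℕ) :
    (∃ h : L2 N, ∀ m, 1 ≤ m → cell h m = c (m + k)) ↔
      ∃ g : L2 N, ∀ m, 1 ≤ m → cell g m = c m := by
  rw [exists_cell_eq_iff_summable c, exists_cell_eq_iff_summable fun m => c (m + k),
    ← summable_nat_add_iff (f := fun m : ℕ => ‖WithLp.toLp 2 (c (m + 1))‖ ^ (2 : ℝ)) k]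
  simp only [add_right_comm _ 1 k]

theorem finCell_of_lt {K : ℕ} (u : Fin K → Fin N → ℂ) {m : ℕ} (hm : m < K) :
    finCell u (m + 1) = u ⟨m, hm⟩ := by
  simp [finCell, hm]

theorem finCell_eq_zero {K : ℕ} (u : Fin K → Fin N → ℂ) {m : ℕ} (hm : K < m) :
    finCell u m = 0 := by
  obtain ⟨m, rfl⟩ := Nat.exists_eq_add_of_le' (Nat.one_le_of_lt hm)
  simp [finCell, show ¬ m < K by omega]

theorem exists_cell_eq_finCell {K : ℕ} (u : Fin K → Fin N → ℂ) :
    ∃ g : L2 N, ∀ m, 1 ≤ m → cell g m = finCell u m := by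
  rw [← exists_cell_eq_shift_iff _ K]
  refine ⟨0, fun m hm => ?_⟩
  rw [finCell_eq_zero u (by omega)]
  obtain ⟨m, rfl⟩ := Nat.exists_eq_add_of_le' hm
  ext i
  simp [cell]

/-- The element of `l²` with finitely many prescribed cells, and zero in all others. -/
def ofFinCells {K : ℕ} (u : Fin K → Fin N → ℂ) : L2 N := (exists_cell_eq_finCell u).choose

theorem cell_ofFinCells {K : ℕ} (u : Fin K → Fin N → ℂ) (m : ℕ) :
    cell (ofFinCells u) m = finCell u m := by
  cases m with
  | zero => rfl
  | succ m => exact (exists_cell_eq_finCell u).choose_spec _ (by omega)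

/-- `ofFinCells` as a linear map. -/
def ofFinCellsₗ (N K : ℕ) : (Fin K → Fin N → ℂ) →ₗ[ℂ] L2 N where
  toFun := ofFinCells
  map_add' u v := cell_ext fun m hm => by
    obtain ⟨m, rfl⟩ := Nat.exists_eq_add_of_le' hm
    rw [cell_add]
    simp only [cell_ofFinCells, finCell]
    split_ifs <;> simp
  map_smul' c u := cell_ext fun m hm => by
    obtain ⟨m, rfl⟩ := Nat.exists_eq_add_of_le' hm
    rw [RingHom.id_apply, cell_smul]
    simp only [cell_ofFinCells, finCell]
    split_ifs <;> simp

/-- `cell · m` as a linear map. -/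
def cellₗ (N m : ℕ) : L2 N →ₗ[ℂ] Fin N → ℂ where
  toFun ψ := cell ψ m
  map_add' φ ψ := cell_add φ ψ m
  map_smul' c ψ := cell_smul c ψ m

/-- The first `K` cells of `ψ`, as a linear map. -/
def firstCellsₗ (N K : ℕ) : L2 N →ₗ[ℂ] Fin K → Fin N → ℂ :=
  LinearMap.pi fun j => cellₗ N (j + 1)

theorem ofFinCells_firstCells {K : ℕ} {ψ : L2 N} (h : ∀ m, K < m → cell ψ m = 0) :
    ofFinCellsₗ N K (firstCellsₗ N K ψ) = ψ := by
  refine cell_ext fun m hm => ?_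
  refine (cell_ofFinCells _ m).trans ?_
  rcases le_or_gt m K with hK | hK
  · obtain ⟨m, rfl⟩ := Nat.exists_eq_add_of_le' hm
    rw [finCell_of_lt _ hK]
    rfl
  · rw [finCell_eq_zero _ hK, h m hK]

theorem firstCells_ofFinCells {K : ℕ} (u : Fin K → Fin N → ℂ) :
    firstCellsₗ N K (ofFinCellsₗ N K u) = u := by
  ext1 j
  exact (cell_ofFinCells u _).trans (finCell_of_lt u j.2)

/-- The cells `k + 1` and `k + 2` of `ψ`, as a linear map. -/
def pairCellsₗ (N k : ℕ) : L2 N →ₗ[ℂ] Fin N ⊕ Fin N → ℂ where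
  toFun ψ := Sum.elim (cell ψ (k + 1)) (cell ψ (k + 2))
  map_add' φ ψ := by ext (i | i) <;> simp [cell_add]
  map_smul' c ψ := by ext (i | i) <;> simp [cell_smul]

/-! ### The matrix `S(z)` and the recurrence -/

/-- The last group of columns starts at `n + 2m ≥ n + m = N`. -/
theorem colSplit_inr {n m : ℕ} (h : n + m = N) (j : Fin n) :
    ∃ i, colSplit h (Sum.inr j) = Sum.inr i := by
  rcases hc : colSplit h (Sum.inr j) with i | i
  · exfalso
    have h1 : (finSumFinEquiv (colSplit h (Sum.inr j)) : ℕ) = n + 2 * m + j := by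
      simp [colSplit]
    rw [hc] at h1
    have := i.2
    simp at h1
    omega
  · exact ⟨i, rfl⟩

/-- In the singular form, the kernel of `S` lies in the second half of the coordinates. -/
theorem HasSingularForm.apply_inl_eq_zero
    {S : Matrix (Fin N ⊕ Fin N) (Fin N ⊕ Fin N) ℂ} (hS : HasSingularForm S)
    {x : Fin N ⊕ Fin N → ℂ} (hx : S *ᵥ x = 0) (i : Fin N) : x (Sum.inl i) = 0 := by
  obtain ⟨n, m, h, M₁₁, M₁₂, M₂₁, M₂₂, -, hform, h21, hschur⟩ := hS
  have hx' : S.submatrix (rowSplit h) (colSplit h) *ᵥ (x ∘ colSplit h) = 0 := by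
    rw [submatrix_mulVec_equiv]
    simp only [Function.comp_assoc, Equiv.self_comp_symm, Function.comp_id, hx]
    rfl
  set y := x ∘ colSplit h
  set y₁ : Fin n → ℂ := fun j => y (Sum.inl (Sum.inl j))
  set y₂ : Fin (2 * m) → ℂ := fun j => y (Sum.inl (Sum.inr j))
  rw [hform, fromBlocks_mulVec] at hx'
  have hinner : fromBlocks M₁₁ M₁₂ M₂₁ M₂₂ *ᵥ (y ∘ Sum.inl) = 0 := by
    ext r
    simpa using congrFun hx' (Sum.inr r)
  rw [fromBlocks_mulVec] at hinner
  have e1 : M₁₁ *ᵥ y₁ + M₁₂ *ᵥ y₂ = 0 := by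
    ext r
    exact congrFun hinner (Sum.inl r)
  have e2 : M₂₁ *ᵥ y₁ + M₂₂ *ᵥ y₂ = 0 := by
    ext r
    exact congrFun hinner (Sum.inr r)
  have hdet := (isUnit_iff_isUnit_det _).1 h21
  have e3 : y₁ = -((M₂₁⁻¹ * M₂₂) *ᵥ y₂) := by
    have := congrArg (fun v => M₂₁⁻¹ *ᵥ v) e2
    simp only [mulVec_add, mulVec_mulVec, nonsing_inv_mul _ hdet, one_mulVec, mulVec_zero] at this
    exact eq_neg_of_add_eq_zero_left this
  -- Eliminating `y₁` leaves the Schur complement acting on `y₂`.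
  have e4 : y₂ = 0 := by
    apply mulVec_injective_of_isUnit hschur
    rw [mulVec_zero, sub_mulVec, ← e1, Matrix.mul_assoc, ← mulVec_mulVec]
    rw [show M₁₁ *ᵥ y₁ = M₁₁ *ᵥ -((M₂₁⁻¹ * M₂₂) *ᵥ y₂) from congrArg _ e3, mulVec_neg]
    abel
  have e5 : y₁ = 0 := by rw [e3, e4]; simp
  -- Only the last `n` coordinates are unconstrained, and none of them is in the first half.
  rcases hc : (colSplit h).symm (Sum.inl i) with (j | j) | j
  · rw [Equiv.symm_apply_eq] at hc
    rw [hc]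
    exact congrFun e5 j
  · rw [Equiv.symm_apply_eq] at hc
    rw [hc]
    exact congrFun e4 j
  · rw [Equiv.symm_apply_eq] at hc
    obtain ⟨k, hk⟩ := colSplit_inr h j
    rw [hk] at hc
    cases hc

/-- A solution of the constant-coefficient recurrence is determined by two consecutive cells,
provided that the kernel of `S(z)` lies in the second half of the coordinates. -/
theorem eq_zero_of_greenLHS_eq_zero {A V : Matrix (Fin N) (Fin N) ℂ} {z : ℂ}
    (hS : ∀ x, SMatrix A V z *ᵥ x = 0 → ∀ i, x (Sum.inl i) = 0) {c : ℕ → Fin N → ℂ} {k : ℕ}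
    (hc : ∀ m, k + 2 ≤ m → greenLHS (fun _ => A) (fun _ => V) z c m = 0)
    (h1 : c (k + 1) = 0) (h2 : c (k + 2) = 0) (m : ℕ) (hm : k < m) : c m = 0 := by
  have step : ∀ j, c (k + 1 + j) = 0 ∧ c (k + 2 + j) = 0 := by
    intro j
    induction j with
    | zero => exact ⟨h1, h2⟩
    | succ j ih =>
      obtain ⟨i1, i2⟩ := ih
      refine ⟨by rwa [show k + 1 + (j + 1) = k + 2 + j by omega], ?_⟩
      -- `A` may be singular, so one equation does not determine the next cell. After two zero
      -- cells, two successive equations say that `S(z)` kills the next pair, so the first cell of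
      -- that pair vanishes.
      have g1 := hc (k + 2 + j) (by omega)
      have g2 := hc (k + 2 + (j + 1)) (by omega)
      simp only [greenLHS, show k + 2 + j - 1 = k + 1 + j by omega,
        show k + 2 + (j + 1) - 1 = k + 2 + j by omega, i1, i2, mulVec_zero, neg_zero, zero_add,
        zero_sub, add_assoc (k + 2) j 1] at g1 g2
      ext i
      refine hS (Sum.elim (c (k + 2 + (j + 1))) (c (k + 2 + (j + 1) + 1))) ?_ i
      rw [SMatrix, fromBlocks_mulVec]
      simp only [Sum.elim_comp_inl, Sum.elim_comp_inr, neg_mulVec, zero_mulVec, add_zero, g1,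
        ← sub_eq_add_neg, g2]
      ext (i | i) <;> rfl
  have := (step (m - k - 1)).1
  rwa [show k + 1 + (m - k - 1) = m by omega] at this

theorem greenLHS_congr {A V : ℕ → Matrix (Fin N) (Fin N) ℂ} (z : ℂ) {c d : ℕ → Fin N → ℂ} {m : ℕ}
    (h0 : c (m - 1) = d (m - 1)) (h1 : c m = d m) (h2 : c (m + 1) = d (m + 1)) :
    greenLHS A V z c m = greenLHS A V z d m := by
  simp only [greenLHS, h0, h1, h2]

theorem greenLHS_shift (A V : Matrix (Fin N) (Fin N) ℂ) (z : ℂ) (c : ℕ → Fin N → ℂ) {m : ℕ}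
    (hm : 1 ≤ m) (k : ℕ) :
    greenLHS (fun _ => A) (fun _ => V) z (fun j => c (j + k)) m
      = greenLHS (fun _ => A) (fun _ => V) z c (m + k) := by
  simp only [greenLHS, show m - 1 + k = m + k - 1 by omega, add_right_comm m 1 k]

theorem IsPeriodicFrom.eq_of_le {M : ℕ} {A V : ℕ → Matrix (Fin N) (Fin N) ℂ}
    (hper : IsPeriodicFrom M A V) {m : ℕ} (hm : max M 1 ≤ m) :
    A m = A (max M 1) ∧ V m = V (max M 1) := by
  induction m, hm using Nat.le_induction with
  | base => exact ⟨rfl, rfl⟩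
  | succ m hm ih =>
    have := hper m (le_trans (le_max_right _ _) hm) (le_trans (le_max_left _ _) hm)
    exact ⟨this.2.trans ih.1, this.1.trans ih.2⟩

/-- Equation `m` involves `A (m - 1)`; the bound `M + 2` gives `m - 1 ≥ max M 1` even for `M = 0`.
-/
theorem IsPeriodicFrom.greenLHS_eq {M : ℕ} {A V : ℕ → Matrix (Fin N) (Fin N) ℂ}
    (hper : IsPeriodicFrom M A V) (z : ℂ) (c : ℕ → Fin N → ℂ) {m : ℕ} (hm : M + 2 ≤ m) :
    greenLHS A V z c m
      = greenLHS (fun _ => A (max M 1)) (fun _ => V (max M 1)) z c m := by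
  have h0 := hper.eq_of_le (m := m - 1) (by omega)
  have h1 := hper.eq_of_le (m := m) (by omega)
  simp only [greenLHS, h0.1, h1.1, h1.2]

/-- Two consecutive cells of a solution that is homogeneous from there on are decaying data. -/
theorem IsPeriodicFrom.isDecayingData {M : ℕ} {A V : ℕ → Matrix (Fin N) (Fin N) ℂ}
    (hper : IsPeriodicFrom M A V) {z : ℂ} {g : L2 N}
    (hg : ∀ m, M + 2 ≤ m → greenLHS A V z (cell g) m = 0) :
    IsDecayingData (A (max M 1)) (V (max M 1)) z
      (Sum.elim (cell g (M + 1)) (cell g (M + 2))) := by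
  obtain ⟨h, hh⟩ := (exists_cell_eq_shift_iff (cell g) M).2 ⟨g, fun _ _ => rfl⟩
  refine ⟨h, fun m hm => ?_, ?_⟩
  · rw [greenLHS_congr (d := fun j => cell g (j + M)) z (hh (m - 1) (by omega))
        (hh m (by omega)) (hh (m + 1) (by omega)),
      greenLHS_shift _ _ z _ (by omega), ← hper.greenLHS_eq z _ (by omega), hg _ (by omega)]
  · rw [hh 1 le_rfl, hh 2 (by omega), add_comm 1, add_comm 2]

/-! ### The resolvent -/

theorem IsNearestNeighbour.cell_sub_apply {H : L2 N →L[ℂ] L2 N}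
    {A V : ℕ → Matrix (Fin N) (Fin N) ℂ} (hH : IsNearestNeighbour H A V) (z : ℂ) (g : L2 N)
    {m : ℕ} (hm : 1 ≤ m) : cell (z • g - H g) m = greenLHS A V z (cell g) m := by
  rw [cell_sub, cell_smul, hH.action g m hm, greenLHS, sub_mulVec, smul_mulVec, one_mulVec]
  abel

theorem exists_resolvent {H : L2 N →L[ℂ] L2 N} {z : ℂ} (hz : z ∉ spectrum ℂ H) :
    ∃ T : L2 N ≃ₗ[ℂ] L2 N, ∀ g, T g = z • g - H g := by
  have hu := spectrum.notMem_iff.1 hz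
  refine ⟨(ContinuousLinearEquiv.unitsEquiv ℂ (L2 N) hu.unit).toLinearEquiv, fun g => ?_⟩
  change (algebraMap ℂ (L2 N →L[ℂ] L2 N) z - H) g = _
  simp [Algebra.algebraMap_eq_smul_one]

end EventuallyPeriodic

end

/-! ### Dimension of the decaying data and equivalence with the truncated problem -/

open EventuallyPeriodic in
theorem theorem4p3 {N : ℕ} (M : ℕ) (A V : ℕ → Matrix (Fin N) (Fin N) ℂ)
    (H : L2 N →L[ℂ] L2 N) (hH : IsNearestNeighbour H A V) (hper : IsPeriodicFrom M A V)
    (Ainf Vinf : Matrix (Fin N) (Fin N) ℂ)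
    (hAinf : Ainf = A (max M 1)) (hVinf : Vinf = V (max M 1))
    (z : ℂ) (hz : z ∉ spectrum ℂ H)
    (hS : ¬ IsUnit (SMatrix Ainf Vinf z) → HasSingularForm (SMatrix Ainf Vinf z)) :
    ∃ Vdecaying : Submodule ℂ (Fin N ⊕ Fin N → ℂ),
      Module.finrank ℂ Vdecaying = N ∧
      (∀ x, x ∈ Vdecaying ↔ IsDecayingData Ainf Vinf z x) ∧
      ∀ f : ℕ → Fin N → ℂ, (∀ m, M < m → f m = 0) →
        ∃ g : L2 N, (∀ g' : L2 N, SolvesGreen A V z f g' ↔ g' = g) ∧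
          ∀ u : Fin (M + 2) → Fin N → ℂ,
            (SolvesTruncated M A V z f u ∧
                Sum.elim (finCell u (M + 1)) (finCell u (M + 2)) ∈ Vdecaying) ↔
              ∀ m, 1 ≤ m → m ≤ M + 2 → finCell u m = cell g m := by
  have hker : ∀ x, SMatrix Ainf Vinf z *ᵥ x = 0 → ∀ i, x (Sum.inl i) = 0 := by
    intro x hx i
    by_cases hu : IsUnit (SMatrix Ainf Vinf z)
    · rw [mulVec_injective_of_isUnit hu (hx.trans (mulVec_zero _).symm), Pi.zero_apply]
    · exact (hS hu).apply_inl_eq_zero hx i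
  subst hAinf hVinf
  obtain ⟨T, hT⟩ := exists_resolvent hz
  have hcell : ∀ g {m : ℕ}, 1 ≤ m → cell (T g) m = greenLHS A V z (cell g) m := fun g m hm => by
    rw [hT, hH.cell_sub_apply z g hm]
  -- the decaying data are the cells `M + 1`, `M + 2` of the solutions of `(z - H) g = f` with
  -- `f` supported in the cells `1, …, M + 1`
  set P : (Fin (M + 1) → Fin N → ℂ) →ₗ[ℂ] Fin N ⊕ Fin N → ℂ :=
    pairCellsₗ N M ∘ₗ T.symm.toLinearMap ∘ₗ ofFinCellsₗ N (M + 1) with hP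
  -- the right-hand sides whose solution is supported in the cells `1, …, M`
  set Q : (Fin M → Fin N → ℂ) →ₗ[ℂ] Fin (M + 1) → Fin N → ℂ :=
    firstCellsₗ N (M + 1) ∘ₗ T.toLinearMap ∘ₗ ofFinCellsₗ N M
  -- Nearest-neighbour coupling enlarges the support by at most one cell, so `Q` discards nothing.
  have hQT : ∀ u, ofFinCellsₗ N (M + 1) (Q u) = T (ofFinCellsₗ N M u) := by
    intro u
    refine ofFinCells_firstCells fun m hm => ?_
    have h0 : ∀ j, M < j → cell (ofFinCellsₗ N M u) j = 0 := fun j hj =>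
      (cell_ofFinCells u j).trans (finCell_eq_zero u hj)
    change cell (T (ofFinCellsₗ N M u)) m = 0
    simp only [hcell _ (show 1 ≤ m by omega), greenLHS, h0 (m - 1) (by omega), h0 m (by omega),
      h0 (m + 1) (by omega), mulVec_zero, neg_zero, add_zero, sub_zero]
  have hQinj : Function.Injective Q := by
    intro u v huv
    have := (hQT u).symm.trans ((congrArg _ huv).trans (hQT v))
    rw [← firstCells_ofFinCells u, T.injective this, firstCells_ofFinCells]
  have hrange : LinearMap.range Q = LinearMap.ker P := by
    ext F
    constructor
    · rintro ⟨u, rfl⟩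
      rw [LinearMap.mem_ker]
      have : P (Q u) = pairCellsₗ N M (ofFinCellsₗ N M u) := by
        simp only [hP, LinearMap.comp_apply, hQT u]
        simp
      rw [this]
      change Sum.elim (cell (ofFinCells u) _) (cell (ofFinCells u) _) = 0
      rw [cell_ofFinCells, cell_ofFinCells, finCell_eq_zero u (by omega),
        finCell_eq_zero u (by omega)]
      ext (i | i) <;> rfl
    · intro hF
      set g := T.symm (ofFinCellsₗ N (M + 1) F) with hg
      have hTg : T g = ofFinCellsₗ N (M + 1) F := by simp [hg]
      have hF' : Sum.elim (cell g (M + 1)) (cell g (M + 2)) = 0 := hF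
      have hg0 := eq_zero_of_greenLHS_eq_zero hker (c := cell g) (k := M)
        (fun m hm => by
          rw [← hper.greenLHS_eq z _ hm, ← hcell g (by omega), hTg]
          exact (cell_ofFinCells F m).trans (finCell_eq_zero F (by omega)))
        (funext fun i => congrFun hF' (Sum.inl i)) (funext fun i => congrFun hF' (Sum.inr i))
      refine ⟨firstCellsₗ N M g, ?_⟩
      change firstCellsₗ N (M + 1) (T (ofFinCellsₗ N M (firstCellsₗ N M g))) = F
      rw [ofFinCells_firstCells hg0, hTg, firstCells_ofFinCells]
  have hmem : ∀ x, x ∈ LinearMap.range P ↔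
      IsDecayingData (A (max M 1)) (V (max M 1)) z x := by
    intro x
    constructor
    · rintro ⟨F, rfl⟩
      set g := T.symm (ofFinCellsₗ N (M + 1) F) with hg
      have hTg : T g = ofFinCellsₗ N (M + 1) F := by simp [hg]
      refine hper.isDecayingData (g := g) fun m hm => ?_
      rw [← hcell g (by omega), hTg]
      exact (cell_ofFinCells F _).trans (finCell_eq_zero F (by omega))
    · rintro ⟨h, hh, rfl⟩
      -- Delay `h` by `M` cells and pad with zeros. The equations of `h` from cell 2 on make `T g`
      -- vanish after cell `M + 1`, so its first `M + 1` cells are a preimage under `P`.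
      obtain ⟨g, hg⟩ := (exists_cell_eq_shift_iff
        (fun m => if m ≤ M then 0 else cell h (m - M)) M).1 ⟨h, fun m hm => by
          rw [if_neg (by omega), Nat.add_sub_cancel]⟩
      have hgh : ∀ m, 1 ≤ m → cell g (m + M) = cell h m := fun m hm => by
        rw [hg (m + M) (by omega), if_neg (by omega), Nat.add_sub_cancel]
      refine ⟨firstCellsₗ N (M + 1) (T g), ?_⟩
      have hTg : ofFinCellsₗ N (M + 1) (firstCellsₗ N (M + 1) (T g)) = T g := by
        refine ofFinCells_firstCells fun m hm => ?_
        obtain ⟨k, rfl⟩ := Nat.exists_eq_add_of_le' (show M ≤ m by omega)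
        rw [hcell g (by omega), hper.greenLHS_eq z _ (by omega),
          ← greenLHS_shift _ _ z _ (by omega), ← hh k (by omega)]
        exact greenLHS_congr z (hgh _ (by omega)) (hgh _ (by omega)) (hgh _ (by omega))
      change pairCellsₗ N M (T.symm (ofFinCellsₗ N (M + 1) (firstCellsₗ N (M + 1) (T g)))) = _
      rw [hTg, T.symm_apply_apply, ← hgh 1 le_rfl, ← hgh 2 (by omega), add_comm 1, add_comm 2]
      rfl
  refine ⟨LinearMap.range P, ?_, hmem, fun f hf => ?_⟩
  -- The kernel has dimension `MN`, as the injective image of `Q`.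
  · have h1 := LinearMap.finrank_range_add_finrank_ker P
    rw [← hrange, LinearMap.finrank_range_of_inj hQinj] at h1
    simp only [Module.finrank_pi_fintype, Module.finrank_self, Finset.sum_const, Finset.card_univ,
      Fintype.card_fin, smul_eq_mul, mul_one] at h1
    rw [add_mul, one_mul] at h1
    omega
  · set F : Fin M → Fin N → ℂ := fun j => f (j + 1)
    have hFf : ∀ m, 1 ≤ m → cell (ofFinCells F) m = f m := by
      intro m hm
      rw [cell_ofFinCells]
      rcases le_or_gt m M with h | h
      · obtain ⟨m, rfl⟩ := Nat.exists_eq_add_of_le' hm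
        rw [finCell_of_lt F h]
      · rw [finCell_eq_zero F h, hf m h]
    have huniq : ∀ g' : L2 N, SolvesGreen A V z f g' ↔ g' = T.symm (ofFinCells F) := by
      intro g'
      rw [LinearEquiv.eq_symm_apply]
      constructor
      · intro hg'
        refine cell_ext fun m hm => ?_
        rw [hcell g' hm, hg' m hm, hFf m hm]
      · intro hg' m hm
        rw [← hcell g' hm, hg', hFf m hm]
    refine ⟨T.symm (ofFinCells F), huniq, fun u => ?_⟩
    set g := T.symm (ofFinCells F)
    have hsol : SolvesGreen A V z f g := (huniq g).2 rfl
    constructor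
    · rintro ⟨htr, hu⟩
      obtain ⟨h, hh, hx⟩ := (hmem _).1 hu
      have hu1 : finCell u (M + 1) = cell h 1 := funext fun i => congrFun hx (Sum.inl i)
      have hu2 : finCell u (M + 2) = cell h 2 := funext fun i => congrFun hx (Sum.inr i)
      -- Continue `u` by the delayed `h`; the boundary condition makes them agree in the cells `M +
      -- 1`, `M + 2`. Equations up to `M + 1` then come from `u` and the later ones from `h`, so
      -- uniqueness in `l²` identifies `g'` with `g`.
      obtain ⟨g', hg'⟩ := (exists_cell_eq_shift_iff
        (fun m => if m ≤ M then finCell u m else cell h (m - M)) M).1 ⟨h, fun m hm => by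
          rw [if_neg (by omega), Nat.add_sub_cancel]⟩
      have hgh : ∀ m, 1 ≤ m → cell g' (m + M) = cell h m := fun m hm => by
        rw [hg' (m + M) (by omega), if_neg (by omega), Nat.add_sub_cancel]
      have hgu : ∀ m, m ≤ M + 2 → cell g' m = finCell u m := by
        intro m hm
        rcases Nat.eq_zero_or_pos m with rfl | h0
        · rfl
        rcases le_or_gt m M with h | h
        · rw [hg' m h0, if_pos h]
        · obtain rfl | rfl : m = M + 1 ∨ m = M + 2 := by omega
          · rw [hu1, add_comm, hgh 1 le_rfl]
          · rw [hu2, add_comm, hgh 2 (by omega)]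
      have : SolvesGreen A V z f g' := by
        intro m hm
        rcases le_or_gt m (M + 1) with h | h
        · rw [← htr m hm h]
          exact greenLHS_congr z (hgu _ (by omega)) (hgu _ (by omega)) (hgu _ (by omega))
        · obtain ⟨k, rfl⟩ := Nat.exists_eq_add_of_le' (show M ≤ m by omega)
          rw [hf _ (by omega), hper.greenLHS_eq z _ (by omega),
            ← greenLHS_shift _ _ z _ (by omega), ← hh k (by omega)]
          exact greenLHS_congr z (hgh _ (by omega)) (hgh _ (by omega)) (hgh _ (by omega))
      intro m _ hm
      rw [← (huniq g').1 this, hgu m hm]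
    · intro hu
      have hu0 : ∀ m, m ≤ M + 2 → finCell u m = cell g m := by
        intro m hm
        rcases Nat.eq_zero_or_pos m with rfl | h0
        · rfl
        · exact hu m h0 hm
      refine ⟨fun m hm hm' => ?_, ?_⟩
      · rw [← hsol m hm]
        exact greenLHS_congr z (hu0 _ (by omega)) (hu0 _ (by omega)) (hu0 _ (by omega))
      · rw [hmem, hu0 _ (by omega), hu0 _ le_rfl]
        exact hper.isDecayingData fun m hm => by rw [hsol _ (by omega), hf _ (by omega)]
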